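/- Let $K\subset\mathbb R^3$ be a convex body (a compact convex set with nonempty interior) that is centrally symmetric, $K=-K$, whose boundary $\partial K$ is a $C^\infty$ hypersurface, and that is strongly convex: with the Minkowski gauge $\mu_K(x)=\min\{\lambda\ge 0 : x\in\lambda K\}$ and $h_K=\tfrac12\mu_K^2$, the Hessian $D^2h_K(x)$ is positive definite for every $x$ with $|x|=1$. Suppose that the four sets $$K\cap\{x\ge0,y\ge0,z\ge0\},\quad K\cap\{x\le0,y\ge0,z\ge0\},\quad K\cap\{x\le0,y\le0,z\ge0\},\quad K\cap\{x\ge0,y\le0,z\ge0\}$$ have the same volume, and that the following pairs of planar sets have equal areas: $$K\cap\{x=0,y\ge0,z\ge0\}\ \text{ and }\ K\cap\{x=0,y\le0,z\ge0\};$$ $$K\cap\{x\ge0,y=0,z\ge0\}\ \text{ and }\ K\cap\{x\ge0,y=0,z\le0\};$$ $$K\cap\{x\ge0,y\ge0,z=0\}\ \text{ and }\ K\cap\{x\le0,y\ge0,z=0\}.$$ For $w\in\operatorname{int}K$ put $K^w=\{u\in\mathbb R^3 : (u-w)\cdot(v-w)\le1\text{ for all }v\in K\}$, and let $K^\circ=K^0$.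 Then the volume product of $K$ satisfies $$\mathcal P(K):=\min_{w\in\operatorname{int}K}|K|\,|K^w|\ \ge\ \frac{32}{3},$$ and in particular $|K|\,|K^\circ|\ge\frac{32}{3}$. -/

import Mathlib

open MeasureTheory
open scoped ContDiff Pointwise ENNReal

noncomputable section

/-- Euclidean three-space. -/
abbrev E3 : Type := EuclideanSpace ℝ (Fin 3)

/-- The polar body of `K` with respect to the point `z`. -/
def polarAt (K : Set E3) (z : E3) : Set E3 :=
  {y | ∀ x ∈ K, inner ℝ (y - z) (x - z) ≤ 1}

/-- The polar body of `K` with respect to the origin. -/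
def polarBody (K : Set E3) : Set E3 := polarAt K 0

/-- The volume product: the infimum over interior points `z` of `|K| |K^z|`. -/
def volumeProduct (K : Set E3) : ℝ≥0∞ :=
  ⨅ z ∈ interior K, volume K * volume (polarAt K z)

/-- `S` is a `C^∞` hypersurface: near each of its points it is the zero set of a smooth
function with nonvanishing derivative. -/
def IsSmoothHypersurface (S : Set E3) : Prop :=
  ∀ p ∈ S, ∃ (U : Set E3) (F : E3 → ℝ), IsOpen U ∧ p ∈ U ∧ ContDiffOn ℝ ∞ F U ∧
    (∀ x ∈ U, fderiv ℝ F x ≠ 0) ∧ ∀ x ∈ U, x ∈ S ↔ F x = 0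

/-- The function `h_K = μ_K ^ 2 / 2`, where `μ_K` is the Minkowski gauge. -/
def halfSqGauge (K : Set E3) (x : E3) : ℝ := gauge K x ^ 2 / 2

/-- The Hessian of `h_K` is positive definite at each point of the unit sphere. -/
def IsStronglyConvexBody (K : Set E3) : Prop :=
  ∀ x : E3, ‖x‖ = 1 → ∀ v : E3, v ≠ 0 → 0 < iteratedFDeriv ℝ 2 (halfSqGauge K) x ![v, v]

/-- Centrally symmetric convex bodies in three-space (with nonempty interior) which have smooth
boundary and are strongly convex. -/
structure IsSmoothStronglyConvexSymm (K : ConvexBody E3) : Prop where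
  nonempty_interior : (interior (K : Set E3)).Nonempty
  symm : (K : Set E3) = -(K : Set E3)
  smooth : IsSmoothHypersurface (frontier (K : Set E3))
  stronglyConvex : IsStronglyConvexBody (K : Set E3)

/-- The parts of `K` in the four octants with `z ≥ 0`. -/
def octant1 (K : Set E3) : Set E3 := K ∩ {p | 0 ≤ p 0 ∧ 0 ≤ p 1 ∧ 0 ≤ p 2}
def octant2 (K : Set E3) : Set E3 := K ∩ {p | p 0 ≤ 0 ∧ 0 ≤ p 1 ∧ 0 ≤ p 2}
def octant3 (K : Set E3) : Set E3 := K ∩ {p | p 0 ≤ 0 ∧ p 1 ≤ 0 ∧ 0 ≤ p 2}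
def octant4 (K : Set E3) : Set E3 := K ∩ {p | 0 ≤ p 0 ∧ p 1 ≤ 0 ∧ 0 ≤ p 2}

/-- The quarter sections of `K` by the coordinate planes, as subsets of these planes.
`quarterD`, `quarterE` lie in the `yz`-plane, with coordinates `(y, z)`. -/
def quarterD (K : Set E3) : Set (ℝ × ℝ) := {q | !₂[0, q.1, q.2] ∈ K ∧ 0 ≤ q.1 ∧ 0 ≤ q.2}
def quarterE (K : Set E3) : Set (ℝ × ℝ) := {q | !₂[0, q.1, q.2] ∈ K ∧ q.1 ≤ 0 ∧ 0 ≤ q.2}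
/-- `quarterF`, `quarterG` lie in the `zx`-plane, with coordinates `(x, z)`. -/
def quarterF (K : Set E3) : Set (ℝ × ℝ) := {q | !₂[q.1, 0, q.2] ∈ K ∧ 0 ≤ q.1 ∧ 0 ≤ q.2}
def quarterG (K : Set E3) : Set (ℝ × ℝ) := {q | !₂[q.1, 0, q.2] ∈ K ∧ 0 ≤ q.1 ∧ q.2 ≤ 0}
/-- `quarterH`, `quarterI` lie in the `xy`-plane, with coordinates `(x, y)`. -/
def quarterH (K : Set E3) : Set (ℝ × ℝ) := {q | !₂[q.1, q.2, 0] ∈ K ∧ 0 ≤ q.1 ∧ 0 ≤ q.2}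
def quarterI (K : Set E3) : Set (ℝ × ℝ) := {q | !₂[q.1, q.2, 0] ∈ K ∧ q.1 ≤ 0 ∧ 0 ≤ q.2}

/-- The four upper octant parts of `K` have equal volume, and in each coordinate plane two
adjacent quarter sections have equal area. -/
structure IsEquipartitioned (K : Set E3) : Prop where
  vol12 : volume (octant1 K) = volume (octant2 K)
  vol23 : volume (octant2 K) = volume (octant3 K)
  vol34 : volume (octant3 K) = volume (octant4 K)
  areaDE : volume (quarterD K) = volume (quarterE K)
  areaFG : volume (quarterF K) = volume (quarterG K)
  areaHI : volume (quarterH K) = volume (quarterI K)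

end

/-!
Let `K ⊆ ℝⁿ⁺¹` be a convex body around the origin, and suppose that `K` and its iterated coordinate
sections are cut by the coordinate hyperplanes into orthant parts of equal volume: `V` for `K`, and
`aᵢ` for the section by the `i`-th hyperplane. For `Q ∈ K` consider the orthant containing `Q`. The
cones with apex `Q` over the sections of this part of `K` by the coordinate hyperplanes do not
overlap and lie in it, so `∑ aᵢ |Qᵢ| ≤ (n + 1) V`. Hence the polar body `K°` contains the box with
half-sides `sᵢ = aᵢ / ((n + 1) V)`.

If a convex body `A` contains this box `B`, then `A + t B ⊆ (1 + t) A`, while adding the sides of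
`t B` one at a time gives `|A| + t ∑ 2 sᵢ |Pᵢ A| ≤ |A + t B|` with `Pᵢ` the projection along the
`i`-th axis. Differentiating at `t = 0` yields `∑ 2 sᵢ |Pᵢ A| ≤ (n + 1) |A|`. For `A = K°` the
projection `Pᵢ A` contains the polar of the `i`-th section, by the Hahn–Banach theorem, and
induction on the dimension gives `|K| |K°| ≥ 4ⁿ⁺¹ / (n + 1)!`.

Among all `K^z`, the central polar `K°` has the smallest volume: if `h` is the support function of
the symmetric body `K ⊆ ℝᵈ`, then `d! |K^z| = ∫ exp (⟪z, u⟫ - h u) du`, and averaging over `u` and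
`-u` replaces `exp ⟪z, u⟫` by `cosh ⟪z, u⟫ ≥ 1`.
-/

section LinearPreliminaries

variable {n : ℕ}

/-- The inclusion of `ℝⁿ` into `ℝⁿ⁺¹` as the `i`-th coordinate hyperplane. -/
def coordInclusion (i : Fin (n + 1)) : (Fin n → ℝ) →ₗ[ℝ] (Fin (n + 1) → ℝ) where
  toFun q := i.insertNth (0 : ℝ) q
  map_add' p q := by
    ext j
    refine Fin.succAboveCases i ?_ (fun k => ?_) j <;> simp
  map_smul' c q := by
    ext j
    refine Fin.succAboveCases i ?_ (fun k => ?_) j <;> simp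

/-- The section of `K` by the `i`-th coordinate hyperplane, as a subset of `ℝⁿ`. -/
def coordSection (i : Fin (n + 1)) (K : Set (Fin (n + 1) → ℝ)) : Set (Fin n → ℝ) :=
  coordInclusion i ⁻¹' K

@[simp]
theorem coordInclusion_apply_same (i : Fin (n + 1)) (q : Fin n → ℝ) : coordInclusion i q i = 0 := by
  simp [coordInclusion]

@[simp]
theorem coordInclusion_apply_succAbove (i : Fin (n + 1)) (q : Fin n → ℝ) (j : Fin n) :
    coordInclusion i q (i.succAbove j) = q j := by
  simp [coordInclusion]

theorem coordInclusion_removeNth {i : Fin (n + 1)} {p : Fin (n + 1) → ℝ} (hp : p i = 0) :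
    coordInclusion i (i.removeNth p) = p := by
  change i.insertNth (0 : ℝ) (i.removeNth p) = p
  rw [← hp, Fin.insertNth_self_removeNth]

theorem continuous_coordInclusion (i : Fin (n + 1)) :
    Continuous (coordInclusion i : (Fin n → ℝ) → Fin (n + 1) → ℝ) :=
  LinearMap.continuous_of_finiteDimensional _

theorem continuous_removeNth (i : Fin (n + 1)) :
    Continuous fun p : Fin (n + 1) → ℝ => i.removeNth p := by
  unfold Fin.removeNth
  fun_prop

theorem isCompact_coordSection {K : Set (Fin (n + 1) → ℝ)} (hK : IsCompact K)
    (i : Fin (n + 1)) : IsCompact (coordSection i K) := by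
  refine (hK.image (continuous_removeNth i)).of_isClosed_subset
    (hK.isClosed.preimage (continuous_coordInclusion i)) fun q hq => ⟨_, hq, ?_⟩
  ext j
  simp [Fin.removeNth]

theorem zero_mem_interior_coordSection {K : Set (Fin (n + 1) → ℝ)} (h0 : 0 ∈ interior K)
    (i : Fin (n + 1)) : 0 ∈ interior (coordSection i K) :=
  preimage_interior_subset_interior_preimage (continuous_coordInclusion i)
    (show coordInclusion i 0 ∈ interior K by rwa [map_zero])

end LinearPreliminaries

section Slicing

variable {n : ℕ}

theorem continuous_insertNth (i : Fin (n + 1)) :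
    Continuous fun z : ℝ × (Fin n → ℝ) => (i.insertNth z.1 z.2 : Fin (n + 1) → ℝ) :=
  Continuous.finInsertNth (A := fun _ => ℝ) i continuous_fst continuous_snd

theorem measurePreserving_insertNth (i : Fin (n + 1)) :
    MeasurePreserving fun z : ℝ × (Fin n → ℝ) => (i.insertNth z.1 z.2 : Fin (n + 1) → ℝ) :=
  (volume_preserving_piFinSuccAbove (fun _ : Fin (n + 1) => ℝ) i).symm

theorem volume_eq_lintegral_volume_hyperplane (i : Fin (n + 1)) {A : Set (Fin (n + 1) → ℝ)}
    (hA : MeasurableSet A) :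
    volume A = ∫⁻ x : ℝ, volume {q : Fin n → ℝ | i.insertNth x q ∈ A} := by
  have h := measurePreserving_insertNth i
  rw [← h.measure_preimage hA.nullMeasurableSet, Measure.volume_eq_prod,
    Measure.prod_apply (h.measurable hA)]
  rfl

theorem volume_eq_lintegral_volume_line (i : Fin (n + 1)) {A : Set (Fin (n + 1) → ℝ)}
    (hA : MeasurableSet A) :
    volume A = ∫⁻ q : Fin n → ℝ, volume {x : ℝ | i.insertNth x q ∈ A} := by
  have h := measurePreserving_insertNth i
  rw [← h.measure_preimage hA.nullMeasurableSet, Measure.volume_eq_prod,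
    Measure.prod_apply_symm (h.measurable hA)]
  rfl

end Slicing

section Projections

variable {n : ℕ}

theorem volume_add_volume_le_volume_add {A B : Set ℝ} (hA : IsCompact A) (hB : IsCompact B)
    (hA_ne : A.Nonempty) (hB_ne : B.Nonempty) : volume A + volume B ≤ volume (A + B) := by
  obtain ⟨a, ha, ha_max⟩ := hA.exists_isGreatest hA_ne
  obtain ⟨b, hb, hb_min⟩ := hB.exists_isLeast hB_ne
  -- The translates `A + b` and `a + B` lie in `A + B` and meet only at `a + b`.
  have hdisj : AEDisjoint volume (b +ᵥ A) (a +ᵥ B) := by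
    refine measure_mono_null ?_ (Real.volume_singleton (a := a + b))
    rintro _ ⟨⟨x, hx, rfl⟩, y, hy, hxy⟩
    have hxa := ha_max hx
    have hby := hb_min hy
    simp only [vadd_eq_add] at hxy
    simp only [vadd_eq_add, Set.mem_singleton_iff]
    linarith
  calc volume A + volume B = volume (b +ᵥ A) + volume (a +ᵥ B) := by
        rw [measure_vadd, measure_vadd]
    _ = volume ((b +ᵥ A) ∪ (a +ᵥ B)) :=
        (measure_union₀ (hB.vadd a).measurableSet.nullMeasurableSet hdisj).symm
    _ ≤ volume (A + B) := by
        refine measure_mono (Set.union_subset ?_ ?_)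
        · rintro _ ⟨x, hx, rfl⟩
          exact ⟨x, hx, b, hb, add_comm x b⟩
        · rintro _ ⟨y, hy, rfl⟩
          exact ⟨a, ha, y, hy, rfl⟩

/-- The segment from `-s` to `s` on the `i`-th coordinate axis. -/
def axisSegment (i : Fin n) (s : ℝ) : Set (Fin n → ℝ) :=
  Pi.single i '' Set.Icc (-s) s

theorem isCompact_axisSegment (i : Fin n) (s : ℝ) : IsCompact (axisSegment i s) :=
  isCompact_Icc.image (continuous_single (A := fun _ => ℝ) i)

theorem zero_mem_axisSegment (i : Fin n) {s : ℝ} (hs : 0 ≤ s) : 0 ∈ axisSegment i s :=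
  ⟨0, by simpa using hs, Pi.single_zero i⟩

theorem volume_add_two_mul_volume_image_removeNth_le (i : Fin (n + 1))
    {A : Set (Fin (n + 1) → ℝ)} (hA : IsCompact A) {s : ℝ} (hs : 0 ≤ s) :
    volume A + ENNReal.ofReal (2 * s) * volume (i.removeNth '' A) ≤
      volume (A + axisSegment i s) := by
  have hproj : MeasurableSet (i.removeNth '' A) :=
    (hA.image (continuous_removeNth i)).measurableSet
  rw [volume_eq_lintegral_volume_line i (hA.add (isCompact_axisSegment i s)).measurableSet,
    volume_eq_lintegral_volume_line i hA.measurableSet, ← setLIntegral_const,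
    ← lintegral_indicator hproj, ← lintegral_add_right _ (measurable_const.indicator hproj)]
  refine lintegral_mono fun q => ?_
  set line : Set ℝ := {x | i.insertNth x q ∈ A} with hline_def
  have hline_add : line + Set.Icc (-s) s ⊆ {x | i.insertNth x q ∈ A + axisSegment i s} := by
    rintro _ ⟨x, hx, y, hy, rfl⟩
    refine ⟨_, hx, Pi.single i y, ⟨y, hy, rfl⟩, ?_⟩
    simp only [← Fin.insertNth_zero_right, ← Fin.insertNth_add, add_zero]
  by_cases hq : q ∈ i.removeNth '' A
  · rw [Set.indicator_of_mem hq]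
    have hline : IsCompact line := by
      refine (hA.image (continuous_apply i)).of_isClosed_subset
        (hA.isClosed.preimage ((continuous_insertNth i).comp (Continuous.prodMk_left q)))
        fun x hx => ⟨_, hx, by simp⟩
    have hline_ne : line.Nonempty := by
      obtain ⟨p, hp, rfl⟩ := hq
      exact ⟨p i, by simpa [hline_def] using hp⟩
    calc volume line + ENNReal.ofReal (2 * s)
        = volume line + volume (Set.Icc (-s) s) := by
          rw [Real.volume_Icc, sub_neg_eq_add, two_mul]
      _ ≤ volume (line + Set.Icc (-s) s) :=
          volume_add_volume_le_volume_add hline isCompact_Icc hline_ne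
            (Set.nonempty_Icc.2 (neg_le_self hs))
      _ ≤ _ := measure_mono hline_add
  · rw [Set.indicator_of_notMem hq, add_zero]
    refine measure_mono fun x hx => hline_add ⟨x, hx, 0, by simpa using hs, add_zero x⟩

theorem volume_add_sum_two_mul_volume_image_removeNth_le {A : Set (Fin (n + 1) → ℝ)}
    (hA : IsCompact A) {s : Fin (n + 1) → ℝ} (hs : ∀ i, 0 ≤ s i) (t : Finset (Fin (n + 1))) :
    volume A + ∑ i ∈ t, ENNReal.ofReal (2 * s i) * volume (i.removeNth '' A) ≤
      volume (A + ∑ i ∈ t, axisSegment i (s i)) := by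
  have hcompact (t : Finset (Fin (n + 1))) : IsCompact (∑ i ∈ t, axisSegment i (s i)) :=
    Finset.sum_induction _ IsCompact (fun _ _ => IsCompact.add) isCompact_singleton
      fun i _ => isCompact_axisSegment i _
  have hzero (t : Finset (Fin (n + 1))) : 0 ∈ ∑ i ∈ t, axisSegment i (s i) :=
    Finset.sum_induction _ (0 ∈ ·) (fun _ _ h h' => ⟨0, h, 0, h', add_zero 0⟩) rfl
      fun i _ => zero_mem_axisSegment i (hs i)
  induction t using Finset.induction_on with
  | empty => simp
  | insert i t hi ih =>
    rw [Finset.sum_insert hi, Finset.sum_insert hi, add_comm (axisSegment i (s i)), ← add_assoc A]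
    calc _ = (volume A + ∑ j ∈ t, ENNReal.ofReal (2 * s j) * volume (j.removeNth '' A)) +
          ENNReal.ofReal (2 * s i) * volume (i.removeNth '' A) := by
            rw [add_assoc, add_comm (∑ j ∈ t, _)]
      _ ≤ volume (A + ∑ j ∈ t, axisSegment j (s j)) + ENNReal.ofReal (2 * s i) *
          volume (i.removeNth '' (A + ∑ j ∈ t, axisSegment j (s j))) := by
            gcongr
            exact Set.subset_add_left _ (hzero t)
      _ ≤ _ := volume_add_two_mul_volume_image_removeNth_le i (hA.add (hcompact t)) (hs i)

theorem sum_axisSegment_subset_Icc (s : Fin n → ℝ) :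
    ∑ i, axisSegment i (s i) ⊆ Set.Icc (-s) s := by
  intro x hx
  obtain ⟨g, hg, rfl⟩ := (Set.mem_fintype_sum _ _).1 hx
  choose y hy hyg using hg
  have hsum : ∑ i, g i = y := by
    simp only [← hyg]
    exact Finset.univ_sum_single y
  rw [hsum]
  exact ⟨fun i => (hy i).1, fun i => (hy i).2⟩

theorem add_sum_axisSegment_subset_smul {A : Set (Fin n → ℝ)} (hA : Convex ℝ A)
    {s : Fin n → ℝ} (hbox : Set.Icc (-s) s ⊆ A) {t : ℝ} (ht : 0 < t) :
    A + ∑ i, axisSegment i (t * s i) ⊆ (1 + t) • A := by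
  rw [hA.add_smul zero_le_one ht.le, one_smul]
  refine Set.add_subset_add_left fun x hx => ?_
  obtain ⟨hlower, hupper⟩ := sum_axisSegment_subset_Icc _ hx
  rw [Set.mem_smul_set_iff_inv_smul_mem₀ ht.ne']
  refine hbox ⟨fun i => ?_, fun i => ?_⟩
  · simpa [le_inv_mul_iff₀ ht] using hlower i
  · simpa [inv_mul_le_iff₀ ht] using hupper i

theorem le_mul_of_forall_add_mul_le_one_add_pow_mul {m : ℕ} {a b : ℝ}
    (h : ∀ t, 0 < t → a + t * b ≤ (1 + t) ^ m * a) : b ≤ m * a := by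
  have hderiv : HasDerivAt (fun t : ℝ => (1 + t) ^ m * a) (m * a) 0 := by
    simpa using (((hasDerivAt_id (0 : ℝ)).const_add 1).fun_pow m).mul_const a
  refine ge_of_tendsto hderiv.tendsto_slope_zero_right ?_
  filter_upwards [self_mem_nhdsWithin] with t ht
  have ht_pos : 0 < t := ht
  simp only [zero_add, add_zero, one_pow, one_mul, smul_eq_mul]
  rw [le_inv_mul_iff₀ ht_pos]
  linarith [h t ht_pos]

theorem sum_two_mul_volume_image_removeNth_le {A : Set (Fin (n + 1) → ℝ)} (hA : IsCompact A)
    (hA_convex : Convex ℝ A) {s : Fin (n + 1) → ℝ} (hs : ∀ i, 0 ≤ s i)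
    (hbox : Set.Icc (-s) s ⊆ A) :
    ∑ i, 2 * s i * volume.real (i.removeNth '' A) ≤ (n + 1) * volume.real A := by
  have hproj_ne_top (i : Fin (n + 1)) : volume (i.removeNth '' A) ≠ ⊤ :=
    (hA.image (continuous_removeNth i)).measure_ne_top
  suffices ∀ t, 0 < t → volume.real A + t * ∑ i, 2 * s i * volume.real (i.removeNth '' A) ≤
      (1 + t) ^ (n + 1) * volume.real A by
    exact_mod_cast le_mul_of_forall_add_mul_le_one_add_pow_mul this
  intro t ht
  have hts (i : Fin (n + 1)) : 0 ≤ t * s i := mul_nonneg ht.le (hs i)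
  have hle := (volume_add_sum_two_mul_volume_image_removeNth_le hA hts Finset.univ).trans
    (measure_mono (add_sum_axisSegment_subset_smul hA_convex hbox ht))
  have hle_real := ENNReal.toReal_mono (hA.smul (1 + t)).measure_ne_top hle
  have hterm_ne_top : ∀ i ∈ Finset.univ,
      ENNReal.ofReal (2 * (t * s i)) * volume (i.removeNth '' A) ≠ ⊤ := fun i _ =>
    ENNReal.mul_ne_top ENNReal.ofReal_ne_top (hproj_ne_top i)
  rw [ENNReal.toReal_add hA.measure_ne_top (ENNReal.sum_ne_top.2 hterm_ne_top),
    ENNReal.toReal_sum hterm_ne_top, Measure.addHaar_smul, Module.finrank_fin_fun,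
    ENNReal.toReal_mul, ENNReal.toReal_ofReal (abs_nonneg _), abs_of_pos (by positivity)]
    at hle_real
  refine le_of_eq_of_le ?_ hle_real
  rw [Finset.mul_sum]
  refine congrArg (volume.real A + ·) (Finset.sum_congr rfl fun i _ => ?_)
  rw [ENNReal.toReal_mul, ENNReal.toReal_ofReal (mul_nonneg zero_le_two (hts i)), Measure.real]
  ring

end Projections

section OrthantParts

variable {n : ℕ}

/-- The part of `K` in the open orthant with sign vector `e`. -/
def orthantPart (e : Fin n → ℤˣ) (K : Set (Fin n → ℝ)) : Set (Fin n → ℝ) :=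
  {p | p ∈ K ∧ ∀ i, 0 < e i • p i}

theorem measurableSet_orthantPart (e : Fin n → ℤˣ) {K : Set (Fin n → ℝ)}
    (hK : MeasurableSet K) : MeasurableSet (orthantPart e K) := by
  refine hK.inter ?_
  change MeasurableSet {p : Fin n → ℝ | ∀ i, 0 < e i • p i}
  rw [Set.ofPred_forall]
  exact MeasurableSet.iInter fun i =>
    measurableSet_lt measurable_const ((measurable_pi_apply i).const_smul (e i))

theorem exists_forall_units_smul_eq_abs (p : Fin n → ℝ) :
    ∃ e : Fin n → ℤˣ, ∀ i, e i • p i = |p i| := by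
  have hsign (x : ℝ) : ∃ u : ℤˣ, u • x = |x| := by
    rcases abs_choice x with hx | hx
    · exact ⟨1, by rw [one_smul, hx]⟩
    · exact ⟨-1, by rw [Units.neg_smul, one_smul, hx]⟩
  choose e he using fun i => hsign (p i)
  exact ⟨e, he⟩

theorem orthantPart_neg {K : Set (Fin n → ℝ)} (hK : ∀ p ∈ K, -p ∈ K) (e : Fin n → ℤˣ) :
    orthantPart (-e) K = -orthantPart e K := by
  ext p
  have hmem : p ∈ K ↔ -p ∈ K := ⟨hK p, fun h => neg_neg p ▸ hK _ h⟩
  simp only [orthantPart, Set.mem_neg, Set.mem_ofPred_eq, ← hmem, Pi.neg_apply, Units.neg_smul,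
    smul_neg]

theorem volume_orthantPart_neg {K : Set (Fin n → ℝ)} (hK : ∀ p ∈ K, -p ∈ K) (e : Fin n → ℤˣ) :
    volume (orthantPart (-e) K) = volume (orthantPart e K) := by
  rw [orthantPart_neg hK, Measure.measure_neg]

theorem volume_orthantPart_eq_volume_setOf_nonneg (e : Fin n → ℤˣ) (K : Set (Fin n → ℝ)) :
    volume (orthantPart e K) = volume {p | p ∈ K ∧ ∀ i, 0 ≤ e i • p i} := by
  refine measure_congr ?_
  have hne : ∀ᵐ p : Fin n → ℝ, ∀ i, p i ≠ 0 :=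
    ae_all_iff.2 fun i => Measure.ae_eval_ne (μ := fun _ => volume) i 0
  filter_upwards [hne] with p hp
  refine propext (and_congr_right fun _ => forall_congr' fun i => ?_)
  exact ⟨le_of_lt, fun h => h.lt_of_ne' ((smul_ne_zero_iff_ne (e i)).2 (hp i))⟩

theorem sum_volume_orthantPart_le {K : Set (Fin n → ℝ)} (hK : MeasurableSet K) :
    ∑ e : Fin n → ℤˣ, volume (orthantPart e K) ≤ volume K := by
  have hdisj : Set.PairwiseDisjoint ((Finset.univ : Finset (Fin n → ℤˣ)) : Set (Fin n → ℤˣ))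
      fun e => orthantPart e K := by
    refine fun e _ e' _ hne => Set.disjoint_left.2 fun p hp hp' => hne (funext fun i => ?_)
    have hpos := hp.2 i
    have hpos' := hp'.2 i
    rcases Int.units_eq_one_or (e i) with h | h <;>
      rcases Int.units_eq_one_or (e' i) with h' | h' <;>
      simp only [h, h', Units.neg_smul, one_smul] at hpos hpos' ⊢ <;> linarith
  rw [← measure_biUnion_finset hdisj fun e _ => measurableSet_orthantPart e hK]
  exact measure_mono (Set.iUnion₂_subset fun e _ p hp => hp.1)

theorem volume_orthantPart_pos {K : Set (Fin n → ℝ)} (h0 : 0 ∈ interior K) (e : Fin n → ℤˣ) :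
    0 < volume (orthantPart e K) := by
  have hopen : IsOpen (orthantPart e (interior K)) := by
    refine isOpen_interior.inter ?_
    change IsOpen {p : Fin n → ℝ | ∀ i, 0 < e i • p i}
    rw [Set.ofPred_forall]
    exact isOpen_iInter_of_finite fun i =>
      isOpen_lt continuous_const ((continuous_apply i).const_smul (e i))
  have hlim : Filter.Tendsto (fun t : ℝ => t • fun i => e i • (1 : ℝ)) (nhdsWithin 0 (Set.Ioi 0))
      (nhds 0) := by
    refine (Continuous.tendsto' ?_ _ _ (by simp)).mono_left nhdsWithin_le_nhds
    fun_prop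
  obtain ⟨t, ht, ht_pos⟩ :=
    ((hlim.eventually (isOpen_interior.mem_nhds h0)).and self_mem_nhdsWithin).exists
  have hne : (orthantPart e (interior K)).Nonempty := by
    refine ⟨_, ht, fun i => ?_⟩
    rw [Pi.smul_apply, smul_comm, smul_smul, Int.units_mul_self, one_smul, smul_eq_mul, mul_one]
    exact ht_pos
  exact (hopen.measure_pos volume hne).trans_le
    (measure_mono fun p hp => ⟨interior_subset hp.1, hp.2⟩)

end OrthantParts

section Equipartitions

variable {n : ℕ}

/-- The coordinate hyperplanes divide `K` into orthant parts of equal volume. -/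
def IsOrthantEquipartitioned (K : Set (Fin n → ℝ)) : Prop :=
  ∀ e e' : Fin n → ℤˣ, volume (orthantPart e K) = volume (orthantPart e' K)

/-- The set and all its iterated sections by coordinate hyperplanes are divided into orthant parts
of equal volume. -/
def IsHereditarilyEquipartitioned : {n : ℕ} → Set (Fin n → ℝ) → Prop
  | 0, _ => True
  | _ + 1, K =>
      IsOrthantEquipartitioned K ∧ ∀ i, IsHereditarilyEquipartitioned (coordSection i K)

theorem IsHereditarilyEquipartitioned.isOrthantEquipartitioned {K : Set (Fin n → ℝ)}
    (hK : IsHereditarilyEquipartitioned K) : IsOrthantEquipartitioned K := by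
  cases n with
  | zero => exact fun e e' => by rw [Subsingleton.elim e e']
  | succ n => exact hK.1

theorem isOrthantEquipartitioned_of_symm {K : Set (Fin n → ℝ)} (hK : ∀ p ∈ K, -p ∈ K) (i : Fin n)
    (h : ∀ e e' : Fin n → ℤˣ, e i = 1 → e' i = 1 →
      volume (orthantPart e K) = volume (orthantPart e' K)) :
    IsOrthantEquipartitioned K := by
  have hmove (e : Fin n → ℤˣ) : volume (orthantPart e K) = volume (orthantPart 1 K) := by
    rcases Int.units_eq_one_or (e i) with he | he
    · exact h e 1 he rfl
    · rw [← volume_orthantPart_neg hK e]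
      exact h (-e) 1 (by rw [Pi.neg_apply, he, neg_neg]) rfl
  exact fun e e' => (hmove e).trans (hmove e').symm

theorem isHereditarilyEquipartitioned_fin_one {K : Set (Fin 1 → ℝ)} (hK : ∀ p ∈ K, -p ∈ K) :
    IsHereditarilyEquipartitioned K := by
  refine ⟨isOrthantEquipartitioned_of_symm hK 0 fun e e' he he' => ?_, fun _ => trivial⟩
  rw [funext (Fin.forall_fin_one.2 (he.trans he'.symm))]

theorem neg_mem_coordSection {K : Set (Fin (n + 1) → ℝ)} (hK : ∀ p ∈ K, -p ∈ K)
    (i : Fin (n + 1)) : ∀ q ∈ coordSection i K, -q ∈ coordSection i K := fun q hq => by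
  have h := hK _ hq
  rwa [← map_neg] at h

theorem isHereditarilyEquipartitioned_fin_two {K : Set (Fin 2 → ℝ)} (hK : ∀ p ∈ K, -p ∈ K)
    (h : volume (orthantPart ![1, 1] K) = volume (orthantPart ![-1, 1] K)) :
    IsHereditarilyEquipartitioned K := by
  refine ⟨isOrthantEquipartitioned_of_symm hK 1 fun e e' he he' => ?_, fun i =>
    isHereditarilyEquipartitioned_fin_one (neg_mem_coordSection hK i)⟩
  have hvec (e : Fin 2 → ℤˣ) (he : e 1 = 1) :
      volume (orthantPart e K) = volume (orthantPart ![1, 1] K) := by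
    have he_eq : e = ![e 0, 1] := by
      ext j
      fin_cases j <;> simp [he]
    rcases Int.units_eq_one_or (e 0) with he' | he' <;> rw [he_eq, he']
    exact h.symm
  exact (hvec e he).trans (hvec e' he').symm

end Equipartitions

section Cones

variable {n : ℕ}

/-- The union of the open segments from the apex `Q` to the points of a set `S` in the `i`-th
coordinate hyperplane, which is identified with `ℝⁿ`. The point dividing the segment from
`coordInclusion i q` to `Q` in the ratio `t : 1 - t` has `i`-th coordinate `t * Q i`, so that `t`
and `q` can be recovered from it. If `Q i = 0` then `p i / Q i = 0` and the cone is empty. -/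
def apexCone (i : Fin (n + 1)) (Q : Fin (n + 1) → ℝ) (S : Set (Fin n → ℝ)) :
    Set (Fin (n + 1) → ℝ) :=
  {p | p i / Q i ∈ Set.Ioo (0 : ℝ) 1 ∧
    (1 - p i / Q i)⁻¹ • (i.removeNth p - (p i / Q i) • i.removeNth Q) ∈ S}

theorem measurableSet_apexCone (i : Fin (n + 1)) (Q : Fin (n + 1) → ℝ)
    {S : Set (Fin n → ℝ)} (hS : MeasurableSet S) : MeasurableSet (apexCone i Q S) := by
  have hratio : Measurable fun p : Fin (n + 1) → ℝ => p i / Q i := by fun_prop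
  have hbase : Measurable fun p : Fin (n + 1) → ℝ =>
      (1 - p i / Q i)⁻¹ • (i.removeNth p - (p i / Q i) • i.removeNth Q) :=
    (measurable_const.sub hratio).inv.smul
      ((continuous_removeNth i).measurable.sub (hratio.smul measurable_const))
  exact (hratio measurableSet_Ioo).inter (hbase hS)

theorem volume_setOf_insertNth_mem_apexCone (i : Fin (n + 1)) (Q : Fin (n + 1) → ℝ)
    (S : Set (Fin n → ℝ)) (x : ℝ) :
    volume {q : Fin n → ℝ | i.insertNth x q ∈ apexCone i Q S} =
      ENNReal.ofReal ((Set.Ioo (0 : ℝ) 1).indicator (fun t => (1 - t) ^ n) (x / Q i)) *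
        volume S := by
  by_cases hx : x / Q i ∈ Set.Ioo (0 : ℝ) 1
  · have hpos : 0 < 1 - x / Q i := sub_pos.2 hx.2
    have hslice : {q : Fin n → ℝ | i.insertNth x q ∈ apexCone i Q S} =
        (fun q => q + -((x / Q i) • i.removeNth Q)) ⁻¹'
          ((fun q => (1 - x / Q i)⁻¹ • q) ⁻¹' S) := by
      ext q
      simp only [apexCone, Set.mem_ofPred_eq, Fin.insertNth_apply_same, hx, true_and,
        Fin.removeNth_insertNth, Set.mem_preimage, sub_eq_add_neg]
    rw [hslice, measure_preimage_add_right, Measure.addHaar_preimage_smul _ (inv_ne_zero hpos.ne'),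
      Set.indicator_of_mem hx]
    simp [abs_of_pos hpos]
  · rw [Set.indicator_of_notMem hx]
    simp only [apexCone, Set.mem_ofPred_eq, Fin.insertNth_apply_same, hx, false_and,
      Set.ofPred_false, measure_empty, ENNReal.ofReal_zero, zero_mul]

theorem lintegral_indicator_Ioo_one_sub_pow_div (m : ℕ) {c : ℝ} (hc : c ≠ 0) :
    ∫⁻ x : ℝ, ENNReal.ofReal ((Set.Ioo (0 : ℝ) 1).indicator (fun t => (1 - t) ^ m) (x / c)) =
      ENNReal.ofReal (|c| / (m + 1)) := by
  set g : ℝ → ℝ := (Set.Ioo (0 : ℝ) 1).indicator fun t => (1 - t) ^ m with hg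
  have hg_nonneg (t : ℝ) : 0 ≤ g t :=
    Set.indicator_nonneg (fun t ht => pow_nonneg (sub_nonneg.2 ht.2.le) m) t
  have hg_integrable : Integrable g := by
    have hcont : ContinuousOn (fun t : ℝ => (1 - t) ^ m) (Set.Icc 0 1) := by fun_prop
    exact (integrable_indicator_iff measurableSet_Ioo).2
      ((hcont.integrableOn_compact isCompact_Icc).mono_set Set.Ioo_subset_Icc_self)
  have hg_integral : ∫ t, g t = 1 / (m + 1) := by
    rw [hg, integral_indicator measurableSet_Ioo, ← integral_Ioc_eq_integral_Ioo,
      ← intervalIntegral.integral_of_le zero_le_one,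
      intervalIntegral.integral_comp_sub_left (fun t : ℝ => t ^ m) 1]
    simp
  rw [← ofReal_integral_eq_lintegral_ofReal (hg_integrable.comp_div hc)
    (Filter.Eventually.of_forall fun x => hg_nonneg _), Measure.integral_comp_div, hg_integral,
    smul_eq_mul, mul_one_div]

theorem volume_apexCone (i : Fin (n + 1)) (Q : Fin (n + 1) → ℝ) {S : Set (Fin n → ℝ)}
    (hS : MeasurableSet S) :
    volume (apexCone i Q S) = ENNReal.ofReal (|Q i| / (n + 1)) * volume S := by
  rcases eq_or_ne (Q i) 0 with hQ | hQ
  · have hempty : apexCone i Q S = ∅ := by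
      ext p
      simp [apexCone, hQ]
    simp [hempty, hQ]
  · have hmeas : Measurable fun x : ℝ =>
        ENNReal.ofReal ((Set.Ioo (0 : ℝ) 1).indicator (fun t => (1 - t) ^ n) (x / Q i)) := by
      have hpow : Measurable ((Set.Ioo (0 : ℝ) 1).indicator fun t => (1 - t) ^ n) :=
        Measurable.indicator (by fun_prop) measurableSet_Ioo
      fun_prop
    rw [volume_eq_lintegral_volume_hyperplane i (measurableSet_apexCone i Q hS),
      lintegral_congr (volume_setOf_insertNth_mem_apexCone i Q S), lintegral_mul_const _ hmeas,
      lintegral_indicator_Ioo_one_sub_pow_div n hQ]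

theorem exists_mem_eq_of_mem_apexCone {i : Fin (n + 1)} {Q p : Fin (n + 1) → ℝ}
    {S : Set (Fin n → ℝ)} (hp : p ∈ apexCone i Q S) :
    ∃ q ∈ S, p = (p i / Q i) • Q + (1 - p i / Q i) • coordInclusion i q := by
  obtain ⟨⟨hpos, hlt⟩, hq⟩ := hp
  have hQ : Q i ≠ 0 := by
    intro h
    simp [h] at hpos
  refine ⟨_, hq, ?_⟩
  rw [map_smul, smul_inv_smul₀ (sub_pos.2 hlt).ne']
  ext j
  refine Fin.succAboveCases i ?_ (fun k => ?_) j
  · simp [hQ]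
  · simp [Fin.removeNth]

theorem apexCone_subset {i : Fin (n + 1)} {Q : Fin (n + 1) → ℝ} {K : Set (Fin (n + 1) → ℝ)}
    (hK : Convex ℝ K) (hQ : Q ∈ K) : apexCone i Q (coordSection i K) ⊆ K := by
  intro p hp
  obtain ⟨q, hq, hp_eq⟩ := exists_mem_eq_of_mem_apexCone hp
  rw [hp_eq]
  exact hK hQ hq hp.1.1.le (sub_pos.2 hp.1.2).le (add_sub_cancel _ _)

theorem div_mul_units_smul_lt_of_mem_apexCone {i j : Fin (n + 1)} (hji : j ≠ i)
    {Q p : Fin (n + 1) → ℝ} {e : Fin (n + 1) → ℤˣ} {K : Set (Fin n → ℝ)}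
    (hp : p ∈ apexCone i Q (orthantPart (i.removeNth e) K)) :
    p i / Q i * (e j • Q j) < e j • p j := by
  obtain ⟨q, hq, hp_eq⟩ := exists_mem_eq_of_mem_apexCone hp
  obtain ⟨k, rfl⟩ := Fin.exists_succAbove_eq hji
  have hpk := congrFun hp_eq (i.succAbove k)
  simp only [Pi.add_apply, Pi.smul_apply, smul_eq_mul, coordInclusion_apply_succAbove] at hpk
  rw [hpk, smul_add, ← mul_smul_comm, ← mul_smul_comm]
  exact lt_add_of_pos_right _ (mul_pos (sub_pos.2 hp.1.2) (hq.2 k))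

theorem units_smul_pos_of_mem_apexCone {i : Fin (n + 1)} {Q p : Fin (n + 1) → ℝ} {u : ℤˣ}
    {S : Set (Fin n → ℝ)} (hu : 0 ≤ u • Q i) (hp : p ∈ apexCone i Q S) : 0 < u • Q i := by
  refine hu.lt_of_ne' ((smul_ne_zero_iff_ne u).2 fun hQ => ?_)
  simpa [hQ] using hp.1.1

theorem apexCone_orthantPart_subset {i : Fin (n + 1)} {Q : Fin (n + 1) → ℝ}
    {e : Fin (n + 1) → ℤˣ} {K : Set (Fin (n + 1) → ℝ)} (hK : Convex ℝ K) (hQ : Q ∈ K)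
    (he : ∀ j, 0 ≤ e j • Q j) :
    apexCone i Q (orthantPart (i.removeNth e) (coordSection i K)) ⊆ orthantPart e K := by
  refine fun p hp => ⟨apexCone_subset hK hQ ⟨hp.1, hp.2.1⟩, fun j => ?_⟩
  rcases eq_or_ne j i with rfl | hji
  · have hQj := units_smul_pos_of_mem_apexCone (he j) hp
    have hp_eq : p j = p j / Q j * Q j :=
      (div_mul_cancel₀ _ ((smul_ne_zero_iff_ne _).1 hQj.ne')).symm
    rw [hp_eq, ← mul_smul_comm]
    exact mul_pos hp.1.1 hQj
  · exact (mul_nonneg hp.1.1.le (he j)).trans_lt (div_mul_units_smul_lt_of_mem_apexCone hji hp)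

theorem div_lt_div_of_mem_apexCone {i j : Fin (n + 1)} (hji : j ≠ i) {Q p : Fin (n + 1) → ℝ}
    {e : Fin (n + 1) → ℤˣ} {K : Set (Fin n → ℝ)} (he : 0 < e j • Q j)
    (hp : p ∈ apexCone i Q (orthantPart (i.removeNth e) K)) : p i / Q i < p j / Q j := by
  have hlt := div_mul_units_smul_lt_of_mem_apexCone hji hp
  have hp_eq : p j = p j / Q j * Q j :=
    (div_mul_cancel₀ _ ((smul_ne_zero_iff_ne _).1 he.ne')).symm
  rw [hp_eq, ← mul_smul_comm] at hlt
  exact lt_of_mul_lt_mul_right hlt he.le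

theorem sum_mul_volume_orthantPart_coordSection_le {K : Set (Fin (n + 1) → ℝ)} (hc : IsClosed K)
    (hK : Convex ℝ K) {Q : Fin (n + 1) → ℝ} (hQ : Q ∈ K) {e : Fin (n + 1) → ℤˣ}
    (he : ∀ j, 0 ≤ e j • Q j) :
    ∑ i, ENNReal.ofReal (|Q i| / (n + 1)) *
        volume (orthantPart (i.removeNth e) (coordSection i K)) ≤
      volume (orthantPart e K) := by
  set S := fun i : Fin (n + 1) => orthantPart (i.removeNth e) (coordSection i K)
  have hS (i : Fin (n + 1)) : MeasurableSet (S i) :=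
    measurableSet_orthantPart _ (hc.preimage (continuous_coordInclusion i)).measurableSet
  -- In the cone based on the `i`-th hyperplane the ratio `p j / Q j` is minimal for `j = i`.
  have hdisj : Set.PairwiseDisjoint ((Finset.univ : Finset (Fin (n + 1))) : Set (Fin (n + 1)))
      fun i => apexCone i Q (S i) := fun i _ j _ hij => Set.disjoint_left.2 fun p hpi hpj =>
    lt_asymm
      (div_lt_div_of_mem_apexCone hij.symm (units_smul_pos_of_mem_apexCone (he j) hpj) hpi)
      (div_lt_div_of_mem_apexCone hij (units_smul_pos_of_mem_apexCone (he i) hpi) hpj)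
  calc ∑ i, ENNReal.ofReal (|Q i| / (n + 1)) * volume (S i)
      = ∑ i, volume (apexCone i Q (S i)) := by simp_rw [volume_apexCone _ Q (hS _)]
    _ = volume (⋃ i ∈ (Finset.univ : Finset (Fin (n + 1))), apexCone i Q (S i)) :=
        (measure_biUnion_finset hdisj fun i _ => measurableSet_apexCone i Q (hS i)).symm
    _ ≤ volume (orthantPart e K) :=
        measure_mono (Set.iUnion₂_subset fun i _ => apexCone_orthantPart_subset hK hQ he)

end Cones

section Polarity

variable {n : ℕ}

/-- The polar of `K` with respect to the origin, in coordinates. -/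
def coordPolar (K : Set (Fin n → ℝ)) : Set (Fin n → ℝ) :=
  {u | ∀ p ∈ K, u ⬝ᵥ p ≤ 1}

theorem isClosed_coordPolar (K : Set (Fin n → ℝ)) : IsClosed (coordPolar K) := by
  simp only [coordPolar, Set.ofPred_forall]
  exact isClosed_biInter fun p _ => isClosed_le (by unfold dotProduct; fun_prop) continuous_const

theorem convex_coordPolar (K : Set (Fin n → ℝ)) : Convex ℝ (coordPolar K) := by
  intro u hu v hv a b ha hb hab p hp
  rw [add_dotProduct, smul_dotProduct, smul_dotProduct, smul_eq_mul, smul_eq_mul, ← hab]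
  exact add_le_add (mul_le_of_le_one_right ha (hu p hp)) (mul_le_of_le_one_right hb (hv p hp))

theorem isCompact_coordPolar {K : Set (Fin n → ℝ)} (h0 : 0 ∈ interior K) :
    IsCompact (coordPolar K) := by
  obtain ⟨r, hr, hball⟩ := Metric.nhds_basis_closedBall.mem_iff.1 (mem_interior_iff_mem_nhds.1 h0)
  refine Metric.isCompact_of_isClosed_isBounded (isClosed_coordPolar K) ?_
  refine (Metric.isBounded_Icc (fun _ => -(1 / r)) (fun _ => 1 / r)).subset fun u hu => ?_
  have hmul_le (i : Fin n) (x : ℝ) (hx : |x| ≤ r) : u i * x ≤ 1 := by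
    rw [← dotProduct_single]
    refine hu _ (hball ?_)
    rwa [mem_closedBall_zero_iff, Pi.norm_single]
  refine ⟨fun i => ?_, fun i => ?_⟩
  · have hi := hmul_le i (-r) (by rw [abs_neg, abs_of_pos hr])
    rw [neg_le, le_div_iff₀ hr, neg_mul, ← mul_neg]
    exact hi
  · rw [le_div_iff₀ hr]
    exact hmul_le i r (abs_of_pos hr).le

theorem exists_linearMap_extension_le_one {E : Type*} [AddCommGroup E] [Module ℝ E] {K : Set E}
    (hK : Convex ℝ K) (habs : Absorbent ℝ K) (p : Submodule ℝ E) (f : E →ₗ[ℝ] ℝ)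
    (hf : ∀ x ∈ K, x ∈ p → f x ≤ 1) :
    ∃ g : E →ₗ[ℝ] ℝ, (∀ x ∈ p, g x = f x) ∧ ∀ x ∈ K, g x ≤ 1 := by
  have hf_gauge (x : E) (hx : x ∈ p) : f x ≤ gauge K x := by
    refine le_of_forall_gt_imp_ge_of_dense fun b hb => ?_
    obtain ⟨c, hc, hcb, y, hy, rfl⟩ := exists_lt_of_gauge_lt habs hb
    have hy_mem : y ∈ p := (p.smul_mem_iff hc.ne').1 hx
    calc f (c • y) = c * f y := by rw [map_smul, smul_eq_mul]
      _ ≤ c := mul_le_of_le_one_right hc.le (hf y hy hy_mem)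
      _ ≤ b := hcb.le
  obtain ⟨g, hg, hg_gauge⟩ := exists_extension_of_le_sublinear (f.toPMap p) (gauge K)
    (fun c hc x => gauge_smul_of_nonneg hc.le x) (gauge_add_le hK habs)
    fun x => hf_gauge x x.2
  exact ⟨g, fun x hx => hg ⟨x, hx⟩, fun x hx => (hg_gauge x).trans (gauge_le_one_of_mem hx)⟩

theorem coordInclusion_dotProduct (i : Fin (n + 1)) (v : Fin n → ℝ) (p : Fin (n + 1) → ℝ) :
    coordInclusion i v ⬝ᵥ p = v ⬝ᵥ i.removeNth p := by
  simp [dotProduct, Fin.sum_univ_succAbove _ i, Fin.removeNth]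

theorem coordPolar_coordSection_subset {K : Set (Fin (n + 1) → ℝ)} (hK : Convex ℝ K)
    (h0 : 0 ∈ interior K) (i : Fin (n + 1)) :
    coordPolar (coordSection i K) ⊆ i.removeNth '' coordPolar K := by
  intro v hv
  have habs : Absorbent ℝ K := absorbent_nhds_zero (mem_interior_iff_mem_nhds.1 h0)
  have hv_le : ∀ p ∈ K, p i = 0 → coordInclusion i v ⬝ᵥ p ≤ 1 := fun p hp hpi => by
    rw [coordInclusion_dotProduct]
    exact hv _ (by rwa [coordSection, Set.mem_preimage, coordInclusion_removeNth hpi])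
  obtain ⟨g, hg, hg_le⟩ := exists_linearMap_extension_le_one hK habs
    (LinearMap.ker (LinearMap.proj i : (Fin (n + 1) → ℝ) →ₗ[ℝ] ℝ))
    (dotProductEquiv ℝ (Fin (n + 1)) (coordInclusion i v)) hv_le
  obtain ⟨u, rfl⟩ := (dotProductEquiv ℝ (Fin (n + 1))).surjective g
  refine ⟨u, hg_le, funext fun k => ?_⟩
  have hk := hg (Pi.single (i.succAbove k) 1) (Pi.single_eq_of_ne (Fin.ne_succAbove i k) 1)
  simpa [Fin.removeNth] using hk

end Polarity

section VolumeProduct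

variable {n : ℕ}

theorem volume_orthantPart_ne_top {K : Set (Fin n → ℝ)} (hc : IsCompact K) (e : Fin n → ℤˣ) :
    volume (orthantPart e K) ≠ ⊤ :=
  measure_ne_top_of_subset (fun _ hp => hp.1) hc.measure_ne_top

theorem sum_abs_mul_volume_orthantPart_coordSection_le {K : Set (Fin (n + 1) → ℝ)}
    (hc : IsCompact K) (hK : Convex ℝ K) (heq : IsOrthantEquipartitioned K)
    (hsec : ∀ i, IsOrthantEquipartitioned (coordSection i K)) {Q : Fin (n + 1) → ℝ} (hQ : Q ∈ K) :
    ∑ i, |Q i| * volume.real (orthantPart 1 (coordSection i K)) ≤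
      (n + 1) * volume.real (orthantPart 1 K) := by
  obtain ⟨e, he⟩ := exists_forall_units_smul_eq_abs Q
  have hle := sum_mul_volume_orthantPart_coordSection_le hc.isClosed hK hQ (e := e)
    fun j => (he j).symm ▸ abs_nonneg (Q j)
  simp_rw [heq e 1, fun i => hsec i (i.removeNth e) 1] at hle
  have hle_real := ENNReal.toReal_mono (volume_orthantPart_ne_top hc 1) hle
  rw [ENNReal.toReal_sum fun i _ => ENNReal.mul_ne_top ENNReal.ofReal_ne_top
    (volume_orthantPart_ne_top (isCompact_coordSection hc i) 1)] at hle_real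
  rw [← div_le_iff₀' (by positivity), Finset.sum_div]
  refine le_of_eq_of_le (Finset.sum_congr rfl fun i _ => ?_) hle_real
  rw [ENNReal.toReal_mul, ENNReal.toReal_ofReal (by positivity), div_mul_eq_mul_div, Measure.real]

theorem Icc_subset_coordPolar {K : Set (Fin n → ℝ)} {s : Fin n → ℝ}
    (hs : ∀ p ∈ K, ∑ i, |p i| * s i ≤ 1) : Set.Icc (-s) s ⊆ coordPolar K := by
  refine fun u hu p hp => (Finset.sum_le_sum fun i _ => ?_).trans (hs p hp)
  calc u i * p i ≤ |u i| * |p i| := abs_mul (u i) (p i) ▸ le_abs_self _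
    _ = |p i| * |u i| := mul_comm _ _
    _ ≤ |p i| * s i := by
      gcongr
      exact abs_le.2 ⟨hu.1 i, hu.2 i⟩

theorem two_mul_div_le_volume_orthantPart_mul_volume_coordPolar {K : Set (Fin (n + 1) → ℝ)}
    (hc : IsCompact K) (hK : Convex ℝ K) (h0 : 0 ∈ interior K)
    (heq : IsOrthantEquipartitioned K)
    (hsec : ∀ i, IsOrthantEquipartitioned (coordSection i K)) {β : ℝ}
    (hβ : ∀ i, β ≤ volume.real (orthantPart 1 (coordSection i K)) *
      volume.real (coordPolar (coordSection i K))) :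
    2 * β / (n + 1) ≤ volume.real (orthantPart 1 K) * volume.real (coordPolar K) := by
  set V := volume.real (orthantPart 1 K)
  set a := fun i => volume.real (orthantPart 1 (coordSection i K))
  have hV : 0 < V :=
    ENNReal.toReal_pos (volume_orthantPart_pos h0 1).ne' (volume_orthantPart_ne_top hc 1)
  have hP : IsCompact (coordPolar K) := isCompact_coordPolar h0
  set s : Fin (n + 1) → ℝ := fun i => a i / ((n + 1) * V) with hs_def
  have hs (i : Fin (n + 1)) : 0 ≤ s i := by positivity
  have hbox : Set.Icc (-s) s ⊆ coordPolar K := Icc_subset_coordPolar fun p hp => by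
    simp only [hs_def, ← mul_div_assoc, ← Finset.sum_div]
    exact div_le_one_of_le₀ (sum_abs_mul_volume_orthantPart_coordSection_le hc hK heq hsec hp)
      (by positivity)
  have hproj (i : Fin (n + 1)) : volume.real (coordPolar (coordSection i K)) ≤
      volume.real (i.removeNth '' coordPolar K) :=
    measureReal_mono (coordPolar_coordSection_subset hK h0 i)
      (hP.image (continuous_removeNth i)).measure_ne_top
  have hterm (i : Fin (n + 1)) :
      2 * β / ((n + 1) * V) ≤ 2 * s i * volume.real (i.removeNth '' coordPolar K) :=
    calc 2 * β / ((n + 1) * V)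
        ≤ 2 * (a i * volume.real (i.removeNth '' coordPolar K)) / ((n + 1) * V) := by
          gcongr
          exact (hβ i).trans (mul_le_mul_of_nonneg_left (hproj i) measureReal_nonneg)
      _ = 2 * s i * volume.real (i.removeNth '' coordPolar K) := by
          rw [hs_def]
          ring
  have hsum : (n + 1) * (2 * β / ((n + 1) * V)) ≤ (n + 1) * volume.real (coordPolar K) := by
    refine le_trans ?_ (sum_two_mul_volume_image_removeNth_le hP (convex_coordPolar K) hs hbox)
    simpa using Finset.card_nsmul_le_sum Finset.univ _ _ fun i _ => hterm i
  calc 2 * β / (n + 1) = V * (2 * β / ((n + 1) * V)) := by field_simp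
    _ ≤ V * volume.real (coordPolar K) := by
      gcongr
      exact le_of_mul_le_mul_left hsum (by positivity)

theorem two_pow_div_factorial_le_volume_orthantPart_mul_volume_coordPolar {K : Set (Fin n → ℝ)}
    (hc : IsCompact K) (hK : Convex ℝ K) (h0 : 0 ∈ interior K)
    (heq : IsHereditarilyEquipartitioned K) :
    2 ^ n / n.factorial ≤ volume.real (orthantPart 1 K) * volume.real (coordPolar K) := by
  induction n with
  | zero =>
    have horthant : orthantPart 1 K = Set.univ := by
      refine Set.eq_univ_of_forall fun p => ⟨?_, fun i => i.elim0⟩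
      rw [Subsingleton.elim p 0]
      exact interior_subset h0
    have hpolar : coordPolar K = Set.univ :=
      Set.eq_univ_of_forall fun u p _ => by simp
    simp [horthant, hpolar, Measure.real, volume_pi]
  | succ n ih =>
    refine le_of_eq_of_le ?_ (two_mul_div_le_volume_orthantPart_mul_volume_coordPolar hc hK h0
      heq.1 (fun i => (heq.2 i).isOrthantEquipartitioned) fun i =>
        ih (isCompact_coordSection hc i) (hK.linear_preimage _)
          (zero_mem_interior_coordSection h0 i) (heq.2 i))
    rw [Nat.factorial_succ, pow_succ']
    push_cast
    field_simp

theorem four_pow_div_factorial_le_volume_mul_volume_coordPolar {K : Set (Fin n → ℝ)}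
    (hc : IsCompact K) (hK : Convex ℝ K) (h0 : 0 ∈ interior K)
    (heq : IsHereditarilyEquipartitioned K) :
    4 ^ n / n.factorial ≤ volume.real K * volume.real (coordPolar K) := by
  have hsum := sum_volume_orthantPart_le hc.measurableSet
  simp only [heq.isOrthantEquipartitioned _ 1, Finset.sum_const, Finset.card_univ,
    Fintype.card_fun, Fintype.card_units_int, Fintype.card_fin, nsmul_eq_mul] at hsum
  have hsum_real : 2 ^ n * volume.real (orthantPart 1 K) ≤ volume.real K := by
    simpa [Measure.real] using ENNReal.toReal_mono hc.measure_ne_top hsum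
  calc (4 ^ n / n.factorial : ℝ) = 2 ^ n * (2 ^ n / n.factorial) := by
        rw [← mul_div_assoc, ← mul_pow]
        norm_num
    _ ≤ 2 ^ n * (volume.real (orthantPart 1 K) * volume.real (coordPolar K)) := by
        gcongr
        exact two_pow_div_factorial_le_volume_orthantPart_mul_volume_coordPolar hc hK h0 heq
    _ ≤ volume.real K * volume.real (coordPolar K) := by
        rw [← mul_assoc]
        gcongr

end VolumeProduct

section CoordinateTransfer

variable {n : ℕ}

/-- The set `K` in the coordinate space `ℝⁿ`, which carries the supremum norm instead of the
Euclidean one. -/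
def coordSet (K : Set (EuclideanSpace ℝ (Fin n))) : Set (Fin n → ℝ) :=
  WithLp.toLp 2 ⁻¹' K

theorem volume_coordSet (K : Set (EuclideanSpace ℝ (Fin n))) : volume (coordSet K) = volume K :=
  (EuclideanSpace.volume_preserving_symm_measurableEquiv_toLp (Fin n)).symm.measure_preimage_equiv K

theorem isCompact_coordSet {K : Set (EuclideanSpace ℝ (Fin n))} (hK : IsCompact K) :
    IsCompact (coordSet K) :=
  (PiLp.homeomorph 2 fun _ : Fin n => ℝ).symm.isClosedEmbedding.isCompact_preimage hK

theorem convex_coordSet {K : Set (EuclideanSpace ℝ (Fin n))} (hK : Convex ℝ K) :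
    Convex ℝ (coordSet K) :=
  hK.linear_preimage (WithLp.linearEquiv 2 ℝ (Fin n → ℝ)).symm.toLinearMap

theorem zero_mem_interior_coordSet {K : Set (EuclideanSpace ℝ (Fin n))} (h0 : 0 ∈ interior K) :
    0 ∈ interior (coordSet K) :=
  preimage_interior_subset_interior_preimage (PiLp.continuous_toLp 2 _)
    (show WithLp.toLp 2 0 ∈ interior K by rwa [WithLp.toLp_zero])

theorem coordPolar_coordSet (K : Set E3) : coordPolar (coordSet K) = coordSet (polarBody K) := by
  have hinner (u : Fin 3 → ℝ) (x : E3) :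
      inner ℝ (WithLp.toLp 2 u - 0) (x - 0) = u ⬝ᵥ x.ofLp := by
    rw [sub_zero, sub_zero, EuclideanSpace.inner_eq_star_dotProduct, dotProduct_comm, star_trivial]
  ext u
  refine ⟨fun h x hx => ?_, fun h p hp => ?_⟩
  · rw [hinner]
    exact h x.ofLp hx
  · exact (hinner u _).symm.trans_le (h _ hp)

theorem volume_orthantPart_coordSet (e : Fin n → ℤˣ) (K : Set (EuclideanSpace ℝ (Fin n))) :
    volume (orthantPart e (coordSet K)) = volume {x | x ∈ K ∧ ∀ i, 0 ≤ e i • x i} := by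
  rw [volume_orthantPart_eq_volume_setOf_nonneg, ← volume_coordSet]
  rfl

theorem volume_orthantPart_fin_two (u v : ℤˣ) (L : Set (Fin 2 → ℝ)) :
    volume (orthantPart ![u, v] L) =
      volume {q : ℝ × ℝ | ![q.1, q.2] ∈ L ∧ 0 ≤ u • q.1 ∧ 0 ≤ v • q.2} := by
  rw [volume_orthantPart_eq_volume_setOf_nonneg,
    ← (volume_preserving_finTwoArrow ℝ).symm.measure_preimage_equiv]
  congr 1
  exact Set.ext fun q => and_congr_right fun _ => Fin.forall_fin_two

theorem isOrthantEquipartitioned_coordSet {K : Set E3} (hs : ∀ x ∈ K, -x ∈ K)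
    (heq : IsEquipartitioned K) : IsOrthantEquipartitioned (coordSet K) := by
  have hvol (e : Fin 3 → ℤˣ) (he : e 2 = 1) :
      volume (orthantPart e (coordSet K)) = volume (octant1 K) := by
    rw [volume_orthantPart_coordSet]
    rcases Int.units_eq_one_or (e 0) with h0 | h0 <;>
      rcases Int.units_eq_one_or (e 1) with h1 | h1
    · congr 1
      exact Set.ext fun x => and_congr_right fun _ => by simp [Fin.forall_fin_succ, he, h0, h1]
    · rw [heq.vol12, heq.vol23, heq.vol34]
      congr 1
      exact Set.ext fun x => and_congr_right fun _ => by simp [Fin.forall_fin_succ, he, h0, h1]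
    · rw [heq.vol12]
      congr 1
      exact Set.ext fun x => and_congr_right fun _ => by simp [Fin.forall_fin_succ, he, h0, h1]
    · rw [heq.vol12, heq.vol23]
      congr 1
      exact Set.ext fun x => and_congr_right fun _ => by simp [Fin.forall_fin_succ, he, h0, h1]
  exact isOrthantEquipartitioned_of_symm (fun p hp => hs _ hp) 2 fun e e' he he' =>
    (hvol e he).trans (hvol e' he').symm

theorem toLp_coordInclusion_zero (x y : ℝ) :
    (WithLp.toLp 2 (coordInclusion 0 ![x, y]) : E3) = !₂[0, x, y] := by
  ext j
  fin_cases j <;> rfl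

theorem toLp_coordInclusion_one (x y : ℝ) :
    (WithLp.toLp 2 (coordInclusion 1 ![x, y]) : E3) = !₂[x, 0, y] := by
  ext j
  fin_cases j <;> rfl

theorem toLp_coordInclusion_two (x y : ℝ) :
    (WithLp.toLp 2 (coordInclusion 2 ![x, y]) : E3) = !₂[x, y, 0] := by
  ext j
  fin_cases j <;> rfl

theorem isHereditarilyEquipartitioned_coordSection_coordSet {K : Set E3}
    (hs : ∀ x ∈ K, -x ∈ K) (heq : IsEquipartitioned K) (i : Fin 3) :
    IsHereditarilyEquipartitioned (coordSection i (coordSet K)) := by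
  have hsec := neg_mem_coordSection (K := coordSet K) (fun p hp => hs _ hp) i
  refine isHereditarilyEquipartitioned_fin_two hsec ?_
  fin_cases i
  · convert heq.areaDE using 1 <;> rw [volume_orthantPart_fin_two]
    · simp [quarterD, coordSection, coordSet, toLp_coordInclusion_zero]
    · simp [quarterE, coordSection, coordSet, toLp_coordInclusion_zero]
  · have hneg : (![-1, 1] : Fin 2 → ℤˣ) = -![1, -1] := by simp
    rw [hneg, volume_orthantPart_neg hsec]
    convert heq.areaFG using 1 <;> rw [volume_orthantPart_fin_two]
    · simp [quarterF, coordSection, coordSet, toLp_coordInclusion_one]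
    · simp [quarterG, coordSection, coordSet, toLp_coordInclusion_one]
  · convert heq.areaHI using 1 <;> rw [volume_orthantPart_fin_two]
    · simp [quarterH, coordSection, coordSet, toLp_coordInclusion_two]
    · simp [quarterI, coordSection, coordSet, toLp_coordInclusion_two]

theorem isHereditarilyEquipartitioned_coordSet {K : Set E3} (hs : ∀ x ∈ K, -x ∈ K)
    (heq : IsEquipartitioned K) : IsHereditarilyEquipartitioned (coordSet K) :=
  ⟨isOrthantEquipartitioned_coordSet hs heq,
    isHereditarilyEquipartitioned_coordSection_coordSet hs heq⟩

theorem zero_mem_interior_of_symm {E : Type*} [AddCommGroup E] [Module ℝ E] [TopologicalSpace E]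
    [IsTopologicalAddGroup E] [ContinuousConstSMul ℝ E] {K : Set E} (hK : Convex ℝ K)
    (hs : ∀ x ∈ K, -x ∈ K) (hne : (interior K).Nonempty) : 0 ∈ interior K := by
  obtain ⟨x, hx⟩ := hne
  have hx_neg : -x ∈ interior K :=
    interior_mono (s := Neg.neg ⁻¹' K) (fun y hy => neg_neg y ▸ hs _ hy)
      (preimage_interior_subset_interior_preimage continuous_neg
        (show - -x ∈ interior K by rwa [neg_neg]))
  have hmid := hK.interior hx hx_neg one_half_pos.le one_half_pos.le (add_halves 1)
  rwa [smul_neg, add_neg_cancel] at hmid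

theorem thirtyTwo_div_three_le_volume_mul_volume_polarBody {K : Set E3} (hc : IsCompact K)
    (hK : Convex ℝ K) (hs : ∀ x ∈ K, -x ∈ K) (hne : (interior K).Nonempty)
    (heq : IsEquipartitioned K) :
    (32 / 3 : ℝ≥0∞) ≤ volume K * volume (polarBody K) := by
  have hle := four_pow_div_factorial_le_volume_mul_volume_coordPolar (isCompact_coordSet hc)
    (convex_coordSet hK) (zero_mem_interior_coordSet (zero_mem_interior_of_symm hK hs hne))
    (isHereditarilyEquipartitioned_coordSet hs heq)
  rw [coordPolar_coordSet, Measure.real, Measure.real, volume_coordSet, volume_coordSet,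
    ← ENNReal.toReal_mul] at hle
  have hconst : (4 ^ 3 / (3 : ℕ).factorial : ℝ) = 32 / 3 := by norm_num [Nat.factorial]
  rw [hconst] at hle
  calc (32 / 3 : ℝ≥0∞) = ENNReal.ofReal (32 / 3) := by
        rw [ENNReal.ofReal_div_of_pos (by norm_num), ENNReal.ofReal_ofNat, ENNReal.ofReal_ofNat]
    _ ≤ volume K * volume (polarBody K) := ENNReal.ofReal_le_of_le_toReal hle

end CoordinateTransfer

section LaplaceTransform

theorem lintegral_Ici_exp_neg (c : ℝ) :
    ∫⁻ r in Set.Ici c, ENNReal.ofReal (Real.exp (-r)) = ENNReal.ofReal (Real.exp (-c)) := by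
  rw [← integral_exp_neg_Ioi c, ofReal_integral_eq_lintegral_ofReal (integrableOn_exp_neg_Ioi c)
    (ae_of_all _ fun r => (Real.exp_pos _).le)]
  exact setLIntegral_congr Ioi_ae_eq_Ici.symm

theorem lintegral_Ioi_exp_neg_mul_pow (m : ℕ) :
    ∫⁻ r in Set.Ioi (0 : ℝ), ENNReal.ofReal (Real.exp (-r)) * ENNReal.ofReal (r ^ m) =
      (m.factorial : ℝ≥0∞) := by
  have hs : (0 : ℝ) < m + 1 := by positivity
  have hint := Real.GammaIntegral_convergent hs
  have hGamma := Real.Gamma_eq_integral hs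
  simp only [add_sub_cancel_right, Real.rpow_natCast] at hint hGamma
  have hnonneg : ∀ᵐ r ∂volume.restrict (Set.Ioi (0 : ℝ)), 0 ≤ Real.exp (-r) * r ^ m :=
    ae_restrict_of_forall_mem measurableSet_Ioi fun r hr =>
      mul_nonneg (Real.exp_pos _).le (pow_nonneg hr.le m)
  simp only [← ENNReal.ofReal_mul (Real.exp_pos _).le]
  rw [← ofReal_integral_eq_lintegral_ofReal hint hnonneg, ← hGamma, Real.Gamma_nat_eq_factorial,
    ENNReal.ofReal_natCast]

theorem lintegral_exp_neg_eq_lintegral_measure_sublevel {α : Type*} [MeasurableSpace α]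
    (μ : Measure α) [SFinite μ] {g : α → ℝ} (hg : Measurable g) :
    ∫⁻ u, ENNReal.ofReal (Real.exp (-g u)) ∂μ =
      ∫⁻ r, ENNReal.ofReal (Real.exp (-r)) * μ {u | g u ≤ r} := by
  set ν : Measure ℝ := volume.withDensity fun r => ENNReal.ofReal (Real.exp (-r))
  have hmeas : MeasurableSet {p : α × ℝ | g p.1 ≤ p.2} :=
    measurableSet_le (hg.comp measurable_fst) measurable_snd
  calc ∫⁻ u, ENNReal.ofReal (Real.exp (-g u)) ∂μ
      = ∫⁻ u, ν (Set.Ici (g u)) ∂μ := by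
        simp only [ν, withDensity_apply _ measurableSet_Ici, lintegral_Ici_exp_neg]
    _ = μ.prod ν {p | g p.1 ≤ p.2} := (Measure.prod_apply hmeas).symm
    _ = ∫⁻ r, μ {u | g u ≤ r} ∂ν := Measure.prod_apply_symm hmeas
    _ = ∫⁻ r, ENNReal.ofReal (Real.exp (-r)) * μ {u | g u ≤ r} :=
        lintegral_withDensity_eq_lintegral_mul _ (by fun_prop)
          (measurable_measure_prodMk_right hmeas)

variable {E : Type*} [NormedAddCommGroup E] [NormedSpace ℝ E] [MeasurableSpace E] [BorelSpace E]
  [FiniteDimensional ℝ E] (μ : Measure E) [μ.IsAddHaarMeasure]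

theorem measure_sublevel_eq_pow_finrank_mul {g : E → ℝ}
    (hsmul : ∀ r : ℝ, 0 < r → ∀ u, g (r • u) = r * g u) {r : ℝ} (hr : 0 < r) :
    μ {u | g u ≤ r} = ENNReal.ofReal (r ^ Module.finrank ℝ E) * μ {u | g u ≤ 1} := by
  have hscale : {u | g u ≤ r} = r • {u | g u ≤ 1} := by
    ext u
    rw [Set.mem_smul_set_iff_inv_smul_mem₀ hr.ne', Set.mem_ofPred_eq, Set.mem_ofPred_eq,
      hsmul _ (inv_pos.2 hr), inv_mul_le_iff₀ hr, mul_one]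
  rw [hscale, Measure.addHaar_smul, abs_of_pos (pow_pos hr _)]

theorem lintegral_exp_neg_eq_factorial_mul_measure {g : E → ℝ} (hg : Measurable g)
    (hnonneg : ∀ u, 0 ≤ g u) (hsmul : ∀ r : ℝ, 0 < r → ∀ u, g (r • u) = r * g u) :
    ∫⁻ u, ENNReal.ofReal (Real.exp (-g u)) ∂μ =
      (Module.finrank ℝ E).factorial * μ {u | g u ≤ 1} := by
  have hsupport : (fun r => ENNReal.ofReal (Real.exp (-r)) * μ {u | g u ≤ r}).support ⊆
      Set.Ici 0 := by
    refine Function.support_subset_iff'.2 fun r hr => ?_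
    have hempty : {u | g u ≤ r} = ∅ :=
      Set.eq_empty_of_forall_notMem fun u hu => hr ((hnonneg u).trans hu)
    simp only [hempty, measure_empty, mul_zero]
  calc ∫⁻ u, ENNReal.ofReal (Real.exp (-g u)) ∂μ
      = ∫⁻ r in Set.Ioi 0, ENNReal.ofReal (Real.exp (-r)) * μ {u | g u ≤ r} := by
        rw [lintegral_exp_neg_eq_lintegral_measure_sublevel μ hg,
          ← setLIntegral_eq_of_support_subset hsupport,
          setLIntegral_congr Ioi_ae_eq_Ici]
    _ = ∫⁻ r in Set.Ioi (0 : ℝ), ENNReal.ofReal (Real.exp (-r)) *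
          ENNReal.ofReal (r ^ Module.finrank ℝ E) * μ {u | g u ≤ 1} :=
        setLIntegral_congr_fun measurableSet_Ioi fun r hr => by
          simp only [measure_sublevel_eq_pow_finrank_mul μ hsmul hr, mul_assoc]
    _ = (Module.finrank ℝ E).factorial * μ {u | g u ≤ 1} := by
        rw [lintegral_mul_const _ (by fun_prop), lintegral_Ioi_exp_neg_mul_pow]

theorem measure_le_one_le_measure_sub_le_one {h : E → ℝ} (hh : Measurable h)
    (heven : ∀ u, h (-u) = h u) (hsmul : ∀ r : ℝ, 0 < r → ∀ u, h (r • u) = r * h u)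
    (l : E →ₗ[ℝ] ℝ) (hl : ∀ u, l u ≤ h u) :
    μ {u | h u ≤ 1} ≤ μ {u | h u - l u ≤ 1} := by
  have habs (u : E) : |l u| ≤ h u := abs_le'.2 ⟨hl u, by simpa [heven] using hl (-u)⟩
  have hl_meas : Measurable l := l.continuous_of_finiteDimensional.measurable
  have hLaplace := lintegral_exp_neg_eq_factorial_mul_measure μ hh
    (fun u => (abs_nonneg _).trans (habs u)) hsmul
  have hLaplace_sub := lintegral_exp_neg_eq_factorial_mul_measure μ (hh.sub hl_meas)
    (fun u => sub_nonneg.2 (hl u)) fun r hr u => by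
      simp only [Pi.sub_apply, hsmul r hr, map_smul, smul_eq_mul, mul_sub]
  have hLaplace_add : ∫⁻ u, ENNReal.ofReal (Real.exp (-(h u + l u))) ∂μ =
      ∫⁻ u, ENNReal.ofReal (Real.exp (-(h u - l u))) ∂μ := by
    rw [← lintegral_neg_eq_self]
    simp only [heven, map_neg, sub_eq_add_neg]
  have hpointwise (u : E) : 2 * ENNReal.ofReal (Real.exp (-h u)) ≤
      ENNReal.ofReal (Real.exp (-(h u + l u))) + ENNReal.ofReal (Real.exp (-(h u - l u))) := by
    rw [← ENNReal.ofReal_add (Real.exp_pos _).le (Real.exp_pos _).le, ← ENNReal.ofReal_ofNat,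
      ← ENNReal.ofReal_mul zero_le_two]
    refine ENNReal.ofReal_le_ofReal ?_
    calc 2 * Real.exp (-h u) ≤ 2 * Real.exp (-h u) * Real.cosh (l u) :=
          le_mul_of_one_le_right (by positivity) (Real.one_le_cosh _)
      _ = Real.exp (-(h u + l u)) + Real.exp (-(h u - l u)) := by
          rw [Real.cosh_eq, neg_add, neg_sub, sub_eq_add_neg, Real.exp_add, Real.exp_add]
          ring
  have hkey : 2 * ∫⁻ u, ENNReal.ofReal (Real.exp (-h u)) ∂μ ≤
      2 * ∫⁻ u, ENNReal.ofReal (Real.exp (-(h u - l u))) ∂μ := by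
    rw [← lintegral_const_mul' _ _ ENNReal.ofNat_ne_top, two_mul (∫⁻ _, _ ∂μ)]
    nth_rewrite 1 [← hLaplace_add]
    rw [← lintegral_add_left (by fun_prop)]
    exact lintegral_mono hpointwise
  rw [ENNReal.mul_le_mul_iff_right two_ne_zero ENNReal.ofNat_ne_top, hLaplace] at hkey
  rw [← ENNReal.mul_le_mul_iff_right
    (Nat.cast_ne_zero.2 (Nat.factorial_ne_zero _)) (ENNReal.natCast_ne_top _)]
  exact hkey.trans_eq hLaplace_sub

end LaplaceTransform

section SupportFunction

variable {E : Type*} [NormedAddCommGroup E] [InnerProductSpace ℝ E]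

/-- The support function of `K`. -/
noncomputable def supportFn (K : Set E) (u : E) : ℝ :=
  sSup ((fun v => inner ℝ u v) '' K)

theorem supportFn_le_iff {K : Set E} (hb : Bornology.IsBounded K) (hne : K.Nonempty) {u : E}
    {r : ℝ} : supportFn K u ≤ r ↔ ∀ v ∈ K, inner ℝ u v ≤ r := by
  have hbdd : BddAbove ((fun v => inner ℝ u v) '' K) :=
    ((innerSL ℝ u).lipschitz.isBounded_image hb).bddAbove
  rw [supportFn, csSup_le_iff hbdd (hne.image _), Set.forall_mem_image]

theorem inner_le_supportFn {K : Set E} (hb : Bornology.IsBounded K) {v : E} (hv : v ∈ K) (u : E) :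
    inner ℝ u v ≤ supportFn K u :=
  (supportFn_le_iff hb ⟨v, hv⟩).1 le_rfl v hv

theorem supportFn_smul (K : Set E) {r : ℝ} (hr : 0 ≤ r) (u : E) :
    supportFn K (r • u) = r * supportFn K u := by
  simp only [supportFn, real_inner_smul_left]
  rw [← smul_eq_mul, ← Real.sSup_smul_of_nonneg hr, ← Set.image_smul, Set.image_image]
  rfl

theorem supportFn_neg {K : Set E} (hs : ∀ x ∈ K, -x ∈ K) (u : E) :
    supportFn K (-u) = supportFn K u := by
  have himage : (fun v => inner ℝ (-u) v) '' K = (fun v => inner ℝ u v) '' K := by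
    refine Set.Subset.antisymm ?_ ?_ <;> rintro _ ⟨v, hv, rfl⟩ <;>
      exact ⟨-v, hs v hv, by simp [inner_neg_left, inner_neg_right]⟩
  rw [supportFn, supportFn, himage]

theorem measurable_supportFn [MeasurableSpace E] [BorelSpace E] {K : Set E}
    (hb : Bornology.IsBounded K) (hne : K.Nonempty) : Measurable (supportFn K) := by
  refine measurable_of_Iic fun r => IsClosed.measurableSet ?_
  have hsublevel : supportFn K ⁻¹' Set.Iic r = ⋂ v ∈ K, {u | inner ℝ u v ≤ r} := by
    ext u
    simp only [Set.mem_preimage, Set.mem_Iic, supportFn_le_iff hb hne, Set.mem_iInter,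
      Set.mem_ofPred_eq]
  rw [hsublevel]
  exact isClosed_biInter fun v _ => isClosed_le (by fun_prop) continuous_const

theorem volume_polarAt {K : Set E3} (hb : Bornology.IsBounded K) (hne : K.Nonempty) (z : E3) :
    volume (polarAt K z) = volume {u | supportFn K u - inner ℝ u z ≤ 1} := by
  rw [← measure_preimage_add_right volume (-z) {u | supportFn K u - inner ℝ u z ≤ 1}]
  congr 1
  ext y
  simp only [polarAt, Set.mem_preimage, Set.mem_ofPred_eq, ← sub_eq_add_neg, sub_le_iff_le_add,
    supportFn_le_iff hb hne, inner_sub_right]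

theorem volume_polarBody_le_volume_polarAt {K : Set E3} (hb : Bornology.IsBounded K)
    (hs : ∀ x ∈ K, -x ∈ K) {z : E3} (hz : z ∈ K) :
    volume (polarBody K) ≤ volume (polarAt K z) := by
  rw [polarBody, volume_polarAt hb ⟨z, hz⟩, volume_polarAt hb ⟨z, hz⟩]
  simp only [inner_zero_right, sub_zero, real_inner_comm z]
  exact measure_le_one_le_measure_sub_le_one volume (measurable_supportFn hb ⟨z, hz⟩)
    (supportFn_neg hs) (fun r hr => supportFn_smul K hr.le) (innerₛₗ ℝ z) fun u => by
      simpa only [innerₛₗ_apply_apply, real_inner_comm] using inner_le_supportFn hb hz u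

end SupportFunction

theorem mainTheorem4_general {K : Set E3} (hc : IsCompact K) (hK : Convex ℝ K)
    (hs : ∀ x ∈ K, -x ∈ K) (hne : (interior K).Nonempty) (heq : IsEquipartitioned K) :
    (32 / 3 : ℝ≥0∞) ≤ volumeProduct K ∧ (32 / 3 : ℝ≥0∞) ≤ volume K * volume (polarBody K) := by
  have hcentral := thirtyTwo_div_three_le_volume_mul_volume_polarBody hc hK hs hne heq
  have hpolar (z : E3) (hz : z ∈ interior K) : volume (polarBody K) ≤ volume (polarAt K z) :=
    volume_polarBody_le_volume_polarAt hc.isBounded hs (interior_subset hz)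
  exact ⟨le_iInf₂ fun z hz => hcentral.trans (mul_le_mul_right (hpolar z hz) _), hcentral⟩

theorem mainTheorem4 (K : ConvexBody E3) (hK : IsSmoothStronglyConvexSymm K)
    (heq : IsEquipartitioned (K : Set E3)) :
    (32 / 3 : ℝ≥0∞) ≤ volumeProduct (K : Set E3) ∧
      (32 / 3 : ℝ≥0∞) ≤ volume (K : Set E3) * volume (polarBody (K : Set E3)) :=
  mainTheorem4_general K.isCompact K.convex (fun _ hx => by rw [hK.symm]; simpa using hx)
    hK.nonempty_interior heq
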